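/- Let $N\ge 1$ and let $a,f_0:\mathbf R^N\to\mathbf R$ be $\mathbf Z^N$-periodic functions such that $a\ge a_0$ for some constant $a_0>0$, $|a(y)-a(y')|\le L|y-y'|^{\theta_1}$ and $|f_0(y)-f_0(y')|\le L|y-y'|^{\theta_2}$ for all $y,y'\in\mathbf R^N$, with some $L>0$ and $\theta_1,\theta_2\in(0,1]$. For a jump map $\beta:\mathbf R^M\to\mathbf R^N$ and a measure $dq_0$ on $\mathbf R^M$ consider, for $\lambda>0$, the equations $$(1)\quad \lambda v_\lambda(y)-a(y)\int_{\mathbf R^M}\big[v_\lambda(y+\beta(z))-v_\lambda(y)-\langle\nabla v_\lambda(y),\beta(z)\rangle\big]\,dq_0(z)-f_0(y)=0,\qquad y\in\mathbf R^N,$$ $$(2)\quad \lambda v_\lambda(y)-a(y)\int_{\mathbf R^M}\big[v_\lambda(y+\beta(z))-v_\lambda(y)\big]\,dq_0(z)-f_0(y)=0,\qquad y\in\mathbf R^N.$$ Viscosity solutions are understood as follows. An upper semicontinuous $u$ is a subsolution of (1) (resp. (2)) if, whenever $\phi\in C^2(\mathbf R^N)$, $u(y)=\phi(y)$ and $u-\phi$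 has a global maximum at $y$, the function $z\mapsto u(y+\beta(z))-u(y)-\langle\nabla\phi(y),\beta(z)\rangle$ (resp. $z\mapsto u(y+\beta(z))-u(y)$) is $dq_0$-integrable and, with $I$ its integral, $\lambda u(y)-a(y)I-f_0(y)\le 0$. A supersolution is a lower semicontinuous $u$ satisfying the same with "minimum" and "$\ge 0$". A solution is both. Consider the following pairs $(\beta,dq_0)$, where $\alpha$ is a parameter: 1. $M=N$, $\beta(z)=z$, $dq_0(z)=|z|^{-(N+\alpha)}dz$ on $\{z: z_i>0,\ 1\le i\le N\}$ and $0$ elsewhere; 2. $M=N=1$, $\beta(z)=z$, $dq_0(z)=|z|^{-(1+\alpha)}dz$ on $\{z<0\}$ and $0$ elsewhere; 3. $M=1$, $N=2$, $\beta(z)=(z,\gamma z)$ with $\gamma>0$ irrational, $dq_0(z)=|z|^{-(1+\alpha)}dz$ on $\mathbf R$; 4. $M=N$, $\beta(z)=z$, $dq_0(z)=|z|^{-(N+\alpha)}dz$ on $\mathbf R^N$. **Corollary 3.3.** (i) Let $(\beta,dq_0)$ be one of the pairs 1, 2, 3, 4 with $\alpha\in(1,2)$. Then there is a constant $d$ (depending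 only on $\beta,dq_0,a,f_0$) such that, whenever $v_\lambda$ is a $\mathbf Z^N$-periodic viscosity solution of (1) for every $\lambda>0$, $$\lim_{\lambda\downarrow0}\lambda v_\lambda(y)=d\quad\text{uniformly in } y,$$ and $d$ is the only constant with this property. (ii) The same holds with (2) in place of (1), when $(\beta,dq_0)$ is one of the pairs 1, 3, 4 with $\alpha\in(0,1)$. -/

import Mathlib

open Filter Topology MeasureTheory

namespace LevyErgodic

/-- `ℝⁿ` with the Euclidean norm and Lebesgue measure. -/
abbrev E (n : ℕ) : Type := EuclideanSpace ℝ (Fin n)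

/-- `u` is a function on the torus, i.e. a `ℤᴺ`-periodic function on `ℝᴺ`. -/
def IsPeriodic {N : ℕ} (u : E N → ℝ) : Prop :=
  ∀ (k : Fin N → ℤ) (y : E N), u (y + WithLp.toLp 2 (fun i => (k i : ℝ))) = u y

/-- Hölder continuity with constant `L` and exponent `θ`. -/
def IsHolder {N : ℕ} (L θ : ℝ) (u : E N → ℝ) : Prop :=
  ∀ y y' : E N, |u y - u y'| ≤ L * ‖y - y'‖ ^ θ

/-! ### Lévy operators and viscosity solutions -/

/-- Integrand with first order compensation,
`u(y + β(z)) - u(y) - ⟨∇φ(y), β(z)⟩`, the gradient being taken from the test function `φ`. -/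
noncomputable def compensatedJump {M N : ℕ} (β : E M → E N) (u φ : E N → ℝ)
    (y : E N) (z : E M) : ℝ :=
  u (y + β z) - u y - inner ℝ (gradient φ y) (β z)

/-- Integrand without compensation, `u(y + β(z)) - u(y)`; the test function is not used. -/
def plainJump {M N : ℕ} (β : E M → E N) (u _φ : E N → ℝ) (y : E N) (z : E M) : ℝ :=
  u (y + β z) - u y

/-- `u` is a viscosity subsolution in the whole space of
`lam * u(y) - a(y) ∫ J[u](y, z) dμ(z) - f(y) = 0`,
where the integrand `J` is one of `compensatedJump β`, `plainJump β`: at every point `y` where a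
`C²` function `φ` touches `u` globally from above, the integrand is integrable and the inequality
`≤` holds. -/
def IsViscositySubsolution {M N : ℕ} (J : (E N → ℝ) → (E N → ℝ) → E N → E M → ℝ)
    (μ : Measure (E M)) (a f : E N → ℝ) (lam : ℝ) (u : E N → ℝ) : Prop :=
  UpperSemicontinuous u ∧
    ∀ φ : E N → ℝ, ContDiff ℝ 2 φ → ∀ y : E N, u y = φ y →
      (∀ x : E N, u x - φ x ≤ u y - φ y) →
        Integrable (J u φ y) μ ∧ lam * u y - a y * (∫ z, J u φ y z ∂μ) - f y ≤ 0

/-- `u` is a viscosity supersolution: the same with `C²` functions touching from below and `≥`. -/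
def IsViscositySupersolution {M N : ℕ} (J : (E N → ℝ) → (E N → ℝ) → E N → E M → ℝ)
    (μ : Measure (E M)) (a f : E N → ℝ) (lam : ℝ) (u : E N → ℝ) : Prop :=
  LowerSemicontinuous u ∧
    ∀ φ : E N → ℝ, ContDiff ℝ 2 φ → ∀ y : E N, u y = φ y →
      (∀ x : E N, u y - φ y ≤ u x - φ x) →
        Integrable (J u φ y) μ ∧ 0 ≤ lam * u y - a y * (∫ z, J u φ y z ∂μ) - f y

/-- Periodic viscosity solutions. -/
def IsPeriodicViscositySolution {M N : ℕ} (J : (E N → ℝ) → (E N → ℝ) → E N → E M → ℝ)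
    (μ : Measure (E M)) (a f : E N → ℝ) (lam : ℝ) (u : E N → ℝ) : Prop :=
  IsPeriodic u ∧ IsViscositySubsolution J μ a f lam u ∧
    IsViscositySupersolution J μ a f lam u

/-! ### The rescaled Lévy measures `dq₀` and the jump maps `β` -/

/-- The measure `1_A(z) |z|^{-(M+α)} dz` on `ℝᴹ`. -/
noncomputable def stableOn {M : ℕ} (A : Set (E M)) (α : ℝ) : Measure (E M) :=
  (volume.restrict A).withDensity fun z => ENNReal.ofReal (‖z‖ ^ (-((M : ℝ) + α)))

/-- The open positive orthant. -/
def orthant (M : ℕ) : Set (E M) := {z | ∀ i, 0 < z i}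

/-- The open negative half-line. -/
def negHalfLine : Set (E 1) := {z | z 0 < 0}

/-- The jump map `z ↦ (z, γ z)` from `ℝ` to `ℝ²`. -/
noncomputable def lineMap (γ : ℝ) (z : E 1) : E 2 := !₂[z 0, γ * z 0]

/-- The pairs (jump map, rescaled measure) of the four examples, for exponents in `(1, 2)`. -/
inductive HighOrderExample : (M N : ℕ) → (E M → E N) → Measure (E M) → Prop
  /-- `|z|^{-(N+α)} dz` on the positive orthant, `β(z) = z`. -/
  | positiveOrthant (N : ℕ) (hN : 1 ≤ N) (α : ℝ) (hα : α ∈ Set.Ioo (1 : ℝ) 2) :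
      HighOrderExample N N (fun z => z) (stableOn (orthant N) α)
  /-- `|z|^{-(1+α)} dz` on the negative half-line, `β(z) = z`; this is the rescaled limit of the
  measure with exponent `α₁ < α` for positive jumps and `α₂ = α` for small negative jumps. -/
  | negativeHalfLine (α : ℝ) (hα : α ∈ Set.Ioo (1 : ℝ) 2) :
      HighOrderExample 1 1 (fun z => z) (stableOn negHalfLine α)
  /-- `|z|^{-(1+α)} dz` on the line, `β(z) = (z, γ z)` with irrational slope. -/
  | irrationalLine (γ : ℝ) (hγ : 0 < γ) (hirr : Irrational γ) (α : ℝ)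
      (hα : α ∈ Set.Ioo (1 : ℝ) 2) :
      HighOrderExample 1 2 (lineMap γ) (stableOn Set.univ α)
  /-- `|z|^{-(N+α)} dz` on the whole space, `β(z) = z`; this is the rescaled limit of the tempered
  measure `exp(-γ|z|) |z|^{-(N+α)} dz`. -/
  | wholeSpace (N : ℕ) (hN : 1 ≤ N) (α : ℝ) (hα : α ∈ Set.Ioo (1 : ℝ) 2) :
      HighOrderExample N N (fun z => z) (stableOn Set.univ α)

/-- The pairs (jump map, rescaled measure) of the examples, for exponents in `(0, 1)`. -/
inductive LowOrderExample : (M N : ℕ) → (E M → E N) → Measure (E M) → Prop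
  | positiveOrthant (N : ℕ) (hN : 1 ≤ N) (α : ℝ) (hα : α ∈ Set.Ioo (0 : ℝ) 1) :
      LowOrderExample N N (fun z => z) (stableOn (orthant N) α)
  | irrationalLine (γ : ℝ) (hγ : 0 < γ) (hirr : Irrational γ) (α : ℝ)
      (hα : α ∈ Set.Ioo (0 : ℝ) 1) :
      LowOrderExample 1 2 (lineMap γ) (stableOn Set.univ α)
  | wholeSpace (N : ℕ) (hN : 1 ≤ N) (α : ℝ) (hα : α ∈ Set.Ioo (0 : ℝ) 1) :
      LowOrderExample N N (fun z => z) (stableOn Set.univ α)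

/-- Standing assumptions on the coefficients: `a`, `f` are periodic and Hölder continuous with
exponents in `(0, 1]`, and `a` is bounded below by a positive constant. -/
def IsAdmissible {N : ℕ} (a f : E N → ℝ) : Prop :=
  IsPeriodic a ∧ IsPeriodic f ∧ (∃ a₀ : ℝ, 0 < a₀ ∧ ∀ y, a₀ ≤ a y) ∧
    ∃ L θ₁ θ₂ : ℝ, 0 < L ∧ θ₁ ∈ Set.Ioc (0 : ℝ) 1 ∧ θ₂ ∈ Set.Ioc (0 : ℝ) 1 ∧
      IsHolder L θ₁ a ∧ IsHolder L θ₂ f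

end LevyErgodic

/-!
Divided by `a`, the equation reads `(lam * v - f) / a = ∫ J[v] dμ` with an operator on the
right that commutes with translations. Doubling the variables
(`IsLevyIntegrand.div_le_div_of_max_doubling`) removes this operator altogether: at a maximum
point `(x₀, y₀)` of `u x - v y - ‖x - y‖² / ε`, where `u`, `v` solve the equation with `lam`, `lam'`,
`(lam * u x₀ - f x₀) / a x₀ ≤ (lam' * v y₀ - f y₀) / a y₀`. This is used twice.

With `u = v`, it gives a modulus of continuity of `lam * v` that depends on `a` and `f` only
(`IsLevyIntegrand.exists_modulus`). With `|lam * v| ≤ sup |f|` and the viscosity inequality at a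
maximum point of `v`, this yields a quantitative strong maximum principle: since the jumps, taken
modulo `ℤᴺ`, reach every open subset of the torus with positive measure, the oscillation of
`lam * v` tends to zero (`IsLevyIntegrand.exists_oscillation_le`).

With two solutions for small `lam`, `lam'`, it shows that the nearly constant functions `lam * u`
and `lam' * v` are close to each other (`IsLevyIntegrand.exists_comparison`). So `lam * v` is Cauchy
as `lam ↓ 0`, with a limit that does not depend on the choice of the solutions.

The examples enter only through the density of the jumps in the torus, which for the line of slope
`γ` is the density of `ℤ γ + ℤ` in `ℝ`.
-/

namespace LevyErgodic

/-! ### Periodic functions -/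

/-- The integer vector `k` as a point of `ℝᴺ`. -/
noncomputable def intVec {N : ℕ} (k : Fin N → ℤ) : E N := WithLp.toLp 2 fun i => (k i : ℝ)

@[simp] lemma intVec_apply {N : ℕ} (k : Fin N → ℤ) (i : Fin N) : intVec k i = k i := rfl

lemma IsPeriodic.add_intVec {N : ℕ} {u : E N → ℝ} (hu : IsPeriodic u) (k : Fin N → ℤ) (y : E N) :
    u (y + intVec k) = u y := hu k y

lemma exists_norm_add_intVec_le {N : ℕ} (y : E N) : ∃ k : Fin N → ℤ, ‖y + intVec k‖ ≤ √N := by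
  refine ⟨fun i => -⌊y i⌋, ?_⟩
  rw [EuclideanSpace.norm_eq]
  apply Real.sqrt_le_sqrt
  calc ∑ i, ‖(y + intVec fun i => -⌊y i⌋) i‖ ^ 2 ≤ ∑ _i : Fin N, (1 : ℝ) := by
        refine Finset.sum_le_sum fun i _ => ?_
        have h0 := Int.floor_le (y i)
        have h1 := Int.lt_floor_add_one (y i)
        simp only [PiLp.add_apply, intVec_apply, Real.norm_eq_abs, sq_abs, Int.cast_neg]
        nlinarith
    _ = N := by simp

lemma IsPeriodic.exists_forall_le {N : ℕ} {u : E N → ℝ} (hu : IsPeriodic u) (hc : Continuous u) :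
    ∃ y, ∀ x, u x ≤ u y := by
  obtain ⟨y, -, hy⟩ := (isCompact_closedBall (0 : E N) (√N)).exists_isMaxOn
    ⟨0, by simp⟩ hc.continuousOn
  refine ⟨y, fun x => ?_⟩
  obtain ⟨k, hk⟩ := exists_norm_add_intVec_le x
  rw [← hu.add_intVec k x]
  exact hy (by simpa using hk)

lemma IsPeriodic.neg {N : ℕ} {u : E N → ℝ} (hu : IsPeriodic u) : IsPeriodic fun y => -u y :=
  fun k y => congrArg Neg.neg (hu k y)

lemma IsPeriodic.exists_forall_ge {N : ℕ} {u : E N → ℝ} (hu : IsPeriodic u) (hc : Continuous u) :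
    ∃ y, ∀ x, u y ≤ u x := by
  obtain ⟨y, hy⟩ := hu.neg.exists_forall_le hc.neg
  exact ⟨y, fun x => neg_le_neg_iff.1 (hy x)⟩

lemma IsPeriodic.exists_abs_le {N : ℕ} {u : E N → ℝ} (hu : IsPeriodic u) (hc : Continuous u) :
    ∃ C, ∀ x, |u x| ≤ C := by
  obtain ⟨y, hy⟩ := IsPeriodic.exists_forall_le (u := fun x => |u x|)
    (fun k y => congrArg abs (hu k y)) hc.abs
  exact ⟨_, hy⟩

/-- The function `u x - v y - ‖x - y‖² / ε` of the doubling of variables attains its maximum,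
although it is invariant only under simultaneous translations of `x` and `y`; at a maximum the
penalization is at most the oscillation of `v`. -/
lemma exists_max_doubling {N : ℕ} {u v : E N → ℝ} (hu : IsPeriodic u) (hv : IsPeriodic v)
    (huc : Continuous u) (hvc : Continuous v) {B ε : ℝ} (hε : 0 < ε)
    (hB : ∀ x y, v x - v y ≤ B) :
    ∃ x₀ y₀, (∀ x y, u x - v y - ‖x - y‖ ^ 2 / ε ≤ u x₀ - v y₀ - ‖x₀ - y₀‖ ^ 2 / ε) ∧
      ‖x₀ - y₀‖ ^ 2 ≤ B * ε := by
  have hB0 : 0 ≤ B := by simpa using hB 0 0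
  -- In the variables `(x, h) = (x, x - y)` the function is periodic in `x` and, as `v` has
  -- oscillation at most `B`, larger at `h = 0` than for `‖h‖² ≥ B ε`.
  have hcont : Continuous fun q : E N × E N => u q.1 - v (q.1 - q.2) - ‖q.2‖ ^ 2 / ε := by
    fun_prop
  obtain ⟨⟨x₀, h₀⟩, -, hmax⟩ :=
    ((isCompact_closedBall (0 : E N) (√N)).prod
      (isCompact_closedBall (0 : E N) (√(B * ε)))).exists_isMaxOn
      ⟨(0, 0), by simp⟩ hcont.continuousOn
  have key : ∀ x h, u x - v (x - h) - ‖h‖ ^ 2 / ε ≤ u x₀ - v (x₀ - h₀) - ‖h₀‖ ^ 2 / ε := by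
    intro x h
    obtain ⟨k, hk⟩ := exists_norm_add_intVec_le x
    have hper : v (x + intVec k - h) = v (x - h) := by
      rw [← hv.add_intVec k (x - h)]; congr 1; abel
    by_cases hh : ‖h‖ ≤ √(B * ε)
    · have := hmax (a := (x + intVec k, h)) ⟨by simpa using hk, by simpa using hh⟩
      simpa [hu.add_intVec, hper] using this
    · have h0 := hmax (a := (x + intVec k, 0)) ⟨by simpa using hk, by simp⟩
      simp only [Set.mem_ofPred_eq, sub_zero, hu.add_intVec, hv.add_intVec, norm_zero] at h0
      have h1 : B ≤ ‖h‖ ^ 2 / ε := by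
        rw [le_div_iff₀ hε]
        exact ((Real.sqrt_lt' ((Real.sqrt_nonneg _).trans_lt (not_le.1 hh))).1 (not_le.1 hh)).le
      have h2 := hB x (x - h)
      have h3 : (0 : ℝ) ^ 2 / ε = 0 := by simp
      linarith
  refine ⟨x₀, x₀ - h₀, fun x y => by simpa using key x (x - y), ?_⟩
  have h1 := key x₀ 0
  have h2 := hB x₀ (x₀ - h₀)
  have h3 : ‖h₀‖ ^ 2 / ε ≤ B := by
    simp only [sub_zero, norm_zero] at h1
    have h3 : (0 : ℝ) ^ 2 / ε = 0 := by simp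
    linarith
  rw [div_le_iff₀ hε] at h3
  simpa using h3

/-! ### The coefficients -/

lemma IsHolder.uniformContinuous {N : ℕ} {L θ : ℝ} {u : E N → ℝ} (hL : 0 < L) (hθ : 0 < θ)
    (h : IsHolder L θ u) : UniformContinuous u := by
  rw [Metric.uniformContinuous_iff]
  intro η hη
  refine ⟨(η / L) ^ θ⁻¹, by positivity, fun {x y} hxy => ?_⟩
  rw [dist_eq_norm] at hxy
  rw [Real.dist_eq]
  calc |u x - u y| ≤ L * ‖x - y‖ ^ θ := h x y
    _ < L * ((η / L) ^ θ⁻¹) ^ θ := by gcongr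
    _ = η := by
      rw [← Real.rpow_mul (by positivity), inv_mul_cancel₀ hθ.ne', Real.rpow_one]
      field_simp

/-- Perturbation of the inequality produced by the doubling of variables: at nearby points
`x`, `y`, the inequality `(s - f x) / a x ≤ (t - f y) / a y` forces `s ≤ t` up to a small error,
uniformly for `t` in the range of `f`. -/
lemma exists_le_add_of_div_le {N : ℕ} {a f : E N → ℝ} {a₀ C : ℝ} (ha₀ : 0 < a₀)
    (ha : ∀ y, a₀ ≤ a y) (hau : UniformContinuous a) (hfu : UniformContinuous f)
    (hf : ∀ y, |f y| ≤ C) {η : ℝ} (hη : 0 < η) :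
    ∃ ρ > 0, ∀ x y s t, ‖x - y‖ < ρ → |t| ≤ C → (s - f x) / a x ≤ (t - f y) / a y →
      s ≤ t + η := by
  have hC : 0 ≤ C := (abs_nonneg _).trans (hf 0)
  set κ : ℝ := η / (1 + 2 * C / a₀) with hκ
  have hκ0 : 0 < κ := by positivity
  obtain ⟨ρ₁, hρ₁, h₁⟩ := Metric.uniformContinuous_iff.1 hau κ hκ0
  obtain ⟨ρ₂, hρ₂, h₂⟩ := Metric.uniformContinuous_iff.1 hfu κ hκ0
  refine ⟨min ρ₁ ρ₂, lt_min hρ₁ hρ₂, fun x y s t hxy ht hst => ?_⟩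
  have hax : 0 < a x := ha₀.trans_le (ha x)
  have hay : 0 < a y := ha₀.trans_le (ha y)
  have hda : |a x - a y| ≤ κ := by
    have := h₁ (a := x) (b := y) (by rw [dist_eq_norm]; exact hxy.trans_le (min_le_left _ _))
    rw [Real.dist_eq] at this
    exact this.le
  have hdf : f x - f y ≤ κ := by
    have := h₂ (a := x) (b := y) (by rw [dist_eq_norm]; exact hxy.trans_le (min_le_right _ _))
    rw [Real.dist_eq] at this
    exact (le_abs_self _).trans this.le
  have htf : |t - f y| ≤ 2 * C := (abs_sub _ _).trans (by linarith [hf y])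
  have e1 : (a x - a y) * ((t - f y) / a y) ≤ κ * (2 * C / a₀) := by
    calc _ ≤ |(a x - a y) * ((t - f y) / a y)| := le_abs_self _
      _ = |a x - a y| * (|t - f y| / a y) := by rw [abs_mul, abs_div, abs_of_pos hay]
      _ ≤ κ * (2 * C / a₀) := by
        gcongr
        exact ha y
  have e2 : s - f x ≤ (t - f y) / a y * a x := (div_le_iff₀ hax).1 hst
  have e3 : (t - f y) / a y * a x = (t - f y) + (a x - a y) * ((t - f y) / a y) := by
    field_simp
    ring
  have e4 : κ + κ * (2 * C / a₀) = η := by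
    rw [hκ]; field_simp
  linarith

/-! ### Consequences of the viscosity inequalities -/

/-- The two properties shared by the integrands `compensatedJump β` and `plainJump β`:
monotonicity in the increment of the function when the gradients of the test functions agree, and
the value for a constant test function. -/
structure IsLevyIntegrand {M N : ℕ} (β : E M → E N)
    (J : (E N → ℝ) → (E N → ℝ) → E N → E M → ℝ) : Prop where
  mono : ∀ (u v φ ψ : E N → ℝ) (x y : E N) (z : E M), gradient φ x = gradient ψ y →
    u (x + β z) - u x ≤ v (y + β z) - v y → J u φ x z ≤ J v ψ y z
  const : ∀ (u : E N → ℝ) (c : ℝ) (y : E N) (z : E M),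
    J u (fun _ => c) y z = u (y + β z) - u y

lemma isLevyIntegrand_compensatedJump {M N : ℕ} (β : E M → E N) :
    IsLevyIntegrand β (compensatedJump β) where
  mono u v φ ψ x y z hg h := by
    simp only [compensatedJump, hg]
    linarith
  const u c y z := by simp [compensatedJump, gradient_fun_const]

lemma isLevyIntegrand_plainJump {M N : ℕ} (β : E M → E N) :
    IsLevyIntegrand β (plainJump β) where
  mono _ _ _ _ _ _ _ _ h := h
  const _ _ _ _ := rfl

lemma hasGradientAt_sq_dist_div {N : ℕ} (w : E N) (ε c : ℝ) (x : E N) :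
    HasGradientAt (fun x => c + ‖x - w‖ ^ 2 / ε) ((2 / ε) • (x - w)) x := by
  rw [hasGradientAt_iff_hasFDerivAt]
  have h := ((((hasFDerivAt_id x).sub_const w).norm_sq).const_mul ε⁻¹).const_add c
  refine (h.congr_fderiv ?_).congr_of_eventuallyEq (.of_forall fun y => ?_)
  · ext y
    simp [div_eq_mul_inv]
    ring
  · simp [div_eq_inv_mul]

section Viscosity

variable {M N : ℕ} {β : E M → E N} {J : (E N → ℝ) → (E N → ℝ) → E N → E M → ℝ}
  {μ : Measure (E M)} {a f : E N → ℝ}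

lemma IsPeriodicViscositySolution.continuous {lam : ℝ} {u : E N → ℝ}
    (hu : IsPeriodicViscositySolution J μ a f lam u) : Continuous u :=
  continuous_iff_lower_upperSemicontinuous.2 ⟨hu.2.2.1, hu.2.1.1⟩

/-- Doubling of variables. At a maximum of `u x - v y - ‖x - y‖² / ε` both test functions have the
same gradient and the increments of `u` at `x₀` are dominated by those of `v` at `y₀`. Divided by
`a`, the two equations have the same nonlocal term, which therefore drops out. -/
lemma IsLevyIntegrand.div_le_div_of_max_doubling (hJ : IsLevyIntegrand β J) (ha : ∀ y, 0 < a y)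
    {lam lam' : ℝ} {u v : E N → ℝ} (hu : IsViscositySubsolution J μ a f lam u)
    (hv : IsViscositySupersolution J μ a f lam' v) {ε : ℝ} {x₀ y₀ : E N}
    (hmax : ∀ x y, u x - v y - ‖x - y‖ ^ 2 / ε ≤ u x₀ - v y₀ - ‖x₀ - y₀‖ ^ 2 / ε) :
    (lam * u x₀ - f x₀) / a x₀ ≤ (lam' * v y₀ - f y₀) / a y₀ := by
  set φ : E N → ℝ := fun x => (u x₀ - ‖x₀ - y₀‖ ^ 2 / ε) + ‖x - y₀‖ ^ 2 / ε with hφ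
  set ψ : E N → ℝ := fun y => (v y₀ + ‖x₀ - y₀‖ ^ 2 / ε) + ‖y - x₀‖ ^ 2 / (-ε) with hψ
  have hsymm : ∀ y, ‖y - x₀‖ ^ 2 / (-ε) = -(‖x₀ - y‖ ^ 2 / ε) := fun y => by
    rw [norm_sub_rev, div_neg]
  have hφ2 : ContDiff ℝ 2 φ :=
    contDiff_const.add (((contDiff_id.sub contDiff_const).norm_sq ℝ).div_const ε)
  have hψ2 : ContDiff ℝ 2 ψ :=
    contDiff_const.add (((contDiff_id.sub contDiff_const).norm_sq ℝ).div_const (-ε))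
  obtain ⟨hui, hul⟩ := hu.2 φ hφ2 x₀ (by simp [hφ]) fun x => by
    have := hmax x y₀
    simp only [hφ]
    linarith
  obtain ⟨hvi, hvl⟩ := hv.2 ψ hψ2 y₀ (by simp [hψ, hsymm]) fun y => by
    have := hmax x₀ y
    simp only [hψ, hsymm]
    linarith
  have hgrad : gradient φ x₀ = gradient ψ y₀ := by
    rw [(hasGradientAt_sq_dist_div y₀ ε _ x₀).gradient,
      (hasGradientAt_sq_dist_div x₀ (-ε) _ y₀).gradient, div_neg, neg_smul, ← smul_neg, neg_sub]
  have hint : ∫ z, J u φ x₀ z ∂μ ≤ ∫ z, J v ψ y₀ z ∂μ := by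
    refine integral_mono hui hvi fun z => hJ.mono _ _ _ _ _ _ _ hgrad ?_
    have := hmax (x₀ + β z) (y₀ + β z)
    rw [add_sub_add_right_eq_sub] at this
    linarith
  calc (lam * u x₀ - f x₀) / a x₀ ≤ ∫ z, J u φ x₀ z ∂μ := by
        rw [div_le_iff₀ (ha x₀)]; linarith
    _ ≤ ∫ z, J v ψ y₀ z ∂μ := hint
    _ ≤ (lam' * v y₀ - f y₀) / a y₀ := by
        rw [le_div_iff₀ (ha y₀)]; linarith

/-- Constant test functions at the extrema of a solution bound `lam * u` by the sup norm of the
right-hand side. -/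
lemma IsLevyIntegrand.abs_mul_le (hJ : IsLevyIntegrand β J) (ha : ∀ y, 0 < a y) {C : ℝ}
    (hf : ∀ y, |f y| ≤ C) {lam : ℝ} (hlam : 0 < lam) {u : E N → ℝ}
    (hu : IsPeriodicViscositySolution J μ a f lam u) (x : E N) : |lam * u x| ≤ C := by
  obtain ⟨y, hy⟩ := hu.1.exists_forall_le hu.continuous
  obtain ⟨y', hy'⟩ := hu.1.exists_forall_ge hu.continuous
  have h1 := (hu.2.1.2 (fun _ => u y) contDiff_const y rfl fun x => by linarith [hy x]).2
  have h2 := (hu.2.2.2 (fun _ => u y') contDiff_const y' rfl fun x => by linarith [hy' x]).2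
  simp only [hJ.const] at h1 h2
  have i1 : ∫ z, (u (y + β z) - u y) ∂μ ≤ 0 := integral_nonpos fun z => sub_nonpos.2 (hy _)
  have i2 : 0 ≤ ∫ z, (u (y' + β z) - u y') ∂μ := integral_nonneg fun z => sub_nonneg.2 (hy' _)
  have j1 := mul_nonpos_of_nonneg_of_nonpos (ha y).le i1
  have j2 := mul_nonneg (ha y').le i2
  have k1 := mul_le_mul_of_nonneg_left (hy x) hlam.le
  have k2 := mul_le_mul_of_nonneg_left (hy' x) hlam.le
  have l1 := abs_le.1 (hf y)
  have l2 := abs_le.1 (hf y')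
  exact abs_le.2 ⟨by linarith, by linarith⟩

/-- The functions `lam * u` are equicontinuous, uniformly in `lam`. In the doubling of `u` with
itself the factor `lam` cancels, so the modulus depends on `a` and `f` only. -/
lemma IsLevyIntegrand.exists_modulus (hJ : IsLevyIntegrand β J) {a₀ C : ℝ} (ha₀ : 0 < a₀)
    (ha : ∀ y, a₀ ≤ a y) (hau : UniformContinuous a) (hfu : UniformContinuous f)
    (hf : ∀ y, |f y| ≤ C) {η : ℝ} (hη : 0 < η) :
    ∃ δ > 0, ∀ lam > 0, ∀ u : E N → ℝ, IsPeriodicViscositySolution J μ a f lam u →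
      ∀ x y, ‖x - y‖ < δ → lam * u x ≤ lam * u y + η := by
  have hC : 0 ≤ C := (abs_nonneg _).trans (hf 0)
  obtain ⟨ρ, hρ, hρ'⟩ := exists_le_add_of_div_le ha₀ ha hau hfu hf (half_pos hη)
  -- `ε` is chosen such that maxima of the doubled function satisfy `‖x₀ - y₀‖² ≤ 2 C ε < ρ²`.
  set ε : ℝ := ρ ^ 2 / (2 * C + 1) with hε
  have hε0 : 0 < ε := by positivity
  refine ⟨√(ε * (η / 2)), by positivity, fun lam hlam u hu x y hxy => ?_⟩
  have hbd := hJ.abs_mul_le (fun y => ha₀.trans_le (ha y)) hf hlam hu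
  obtain ⟨x₀, y₀, hmax, hd⟩ := exists_max_doubling (B := 2 * C / lam) hu.1 hu.1 hu.continuous
    hu.continuous (mul_pos hε0 hlam) fun x y => by
      rw [le_div_iff₀ hlam]
      have h1 := abs_le.1 (hbd x)
      have h2 := abs_le.1 (hbd y)
      linarith
  have hlt : ‖x₀ - y₀‖ < ρ := by
    refine lt_of_pow_lt_pow_left₀ 2 hρ.le (hd.trans_lt ?_)
    have h1 : 2 * C / lam * (ε * lam) = 2 * C * ε := by field_simp
    have h2 : (2 * C + 1) * ε = ρ ^ 2 := by rw [hε]; field_simp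
    rw [h1]
    linarith
  have hle := hρ' x₀ y₀ _ _ hlt (hbd y₀)
    (hJ.div_le_div_of_max_doubling (fun y => ha₀.trans_le (ha y)) hu.2.1 hu.2.2 hmax)
  have hxy2 : ‖x - y‖ ^ 2 / ε ≤ η / 2 := by
    rw [div_le_iff₀ hε0, mul_comm]
    exact ((Real.lt_sqrt (norm_nonneg _)).1 hxy).le
  have hm := mul_le_mul_of_nonneg_left (hmax x y) hlam.le
  have hcancel : lam * (‖x - y‖ ^ 2 / (ε * lam)) = ‖x - y‖ ^ 2 / ε := by field_simp
  have hpos : 0 ≤ lam * (‖x₀ - y₀‖ ^ 2 / (ε * lam)) := by positivity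
  linarith

/-- If the jumps reach every open subset of the torus with positive measure, then they reach all
balls of a given radius with measure bounded below. -/
lemma exists_pos_le_measure_jump
    (hμ : ∀ (p : E N) (δ : ℝ), 0 < δ → 0 < μ {z | ∃ k, ‖β z + intVec k - p‖ < δ})
    {δ : ℝ} (hδ : 0 < δ) :
    ∃ m > 0, ∀ p : E N, m ≤ μ {z | ∃ k, ‖β z + intVec k - p‖ < δ} := by
  obtain ⟨t, -, hfin, ht⟩ := (isCompact_closedBall (0 : E N) (√N)).finite_cover_balls
    (half_pos hδ)
  have hne : t.Nonempty := by
    by_contra h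
    rw [Set.not_nonempty_iff_eq_empty] at h
    have := ht (show (0 : E N) ∈ Metric.closedBall 0 (√N) by simp)
    simp [h] at this
  obtain ⟨q, -, hq⟩ := hfin.toFinset.exists_min_image
    (fun q => μ {z | ∃ k, ‖β z + intVec k - q‖ < δ / 2}) (by simpa using hne)
  refine ⟨_, hμ q (δ / 2) (half_pos hδ), fun p => ?_⟩
  obtain ⟨l, hl⟩ := exists_norm_add_intVec_le p
  obtain ⟨r, hr, hpr⟩ := Set.mem_iUnion₂.1
    (ht (show p + intVec l ∈ Metric.closedBall 0 (√N) by simpa using hl))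
  refine (hq r (by simpa using hr)).trans (measure_mono ?_)
  rintro z ⟨k, hk⟩
  refine ⟨k - l, ?_⟩
  rw [Metric.mem_ball, dist_eq_norm] at hpr
  have : β z + intVec (k - l) - p = (β z + intVec k - r) - (p + intVec l - r) := by
    ext i
    simp
    ring
  rw [this]
  exact (norm_sub_le _ _).trans_lt (by linarith)

/-- The oscillation of `lam * u` tends to zero with `lam`: a quantitative strong maximum
principle. At a maximum point `y` of `u`, the equation bounds the integral of the nonnegative
function `z ↦ lam * (u y - u (y + β z))` by a multiple of `lam`, while the jumps from `y` reach a
neighbourhood of any given point with measure bounded below. -/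
lemma IsLevyIntegrand.exists_oscillation_le (hJ : IsLevyIntegrand β J) {a₀ C : ℝ} (ha₀ : 0 < a₀)
    (ha : ∀ y, a₀ ≤ a y) (hau : UniformContinuous a) (hfu : UniformContinuous f)
    (hf : ∀ y, |f y| ≤ C)
    (hμ : ∀ (p : E N) (δ : ℝ), 0 < δ → 0 < μ {z | ∃ k, ‖β z + intVec k - p‖ < δ})
    {η : ℝ} (hη : 0 < η) :
    ∃ l > 0, ∀ lam, 0 < lam → lam < l → ∀ u : E N → ℝ,
      IsPeriodicViscositySolution J μ a f lam u → ∀ x y, lam * u x ≤ lam * u y + η := by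
  have hC : 0 ≤ C := (abs_nonneg _).trans (hf 0)
  obtain ⟨δ, hδ, hmod⟩ := hJ.exists_modulus (μ := μ) ha₀ ha hau hfu hf (half_pos hη)
  obtain ⟨m', hm', hmμ⟩ := exists_pos_le_measure_jump hμ hδ
  -- The measure of a ball may be infinite; a finite lower bound is enough.
  obtain ⟨m, hm, hmle⟩ : ∃ m : ℝ, 0 < m ∧ ENNReal.ofReal m ≤ m' := by
    obtain ⟨r, hr0, hr⟩ := ENNReal.lt_iff_exists_nnreal_btwn.1 hm'
    exact ⟨r, by exact_mod_cast hr0, by simpa using hr.le⟩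
  set D : ℝ := 2 * C / a₀ with hD
  have hD0 : 0 ≤ D := by positivity
  refine ⟨m * (η / 2) / (D + 1), by positivity, fun lam hlam hlt u hu x y => ?_⟩
  obtain ⟨y₁, hy₁⟩ := hu.1.exists_forall_le hu.continuous
  obtain ⟨hi, hle⟩ := hu.2.1.2 (fun _ => u y₁) contDiff_const y₁ rfl
    fun x => by linarith [hy₁ x]
  have hJc : J u (fun _ => u y₁) y₁ = fun z => u (y₁ + β z) - u y₁ :=
    funext fun z => hJ.const _ _ _ _
  rw [hJc] at hi hle
  have hbd := hJ.abs_mul_le (fun y => ha₀.trans_le (ha y)) hf hlam hu y₁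
  set g : E M → ℝ := fun z => lam * (u y₁ - u (y₁ + β z)) with hg
  have hg0 : ∀ z, 0 ≤ g z := fun z => mul_nonneg hlam.le (sub_nonneg.2 (hy₁ _))
  have hgi : Integrable g μ := by
    refine (hi.const_mul (-lam)).congr (.of_forall fun z => ?_)
    simp only [hg]; ring
  have hgle : ∫ z, g z ∂μ ≤ lam * D := by
    have h1 : ∫ z, g z ∂μ = lam * -(∫ z, (u (y₁ + β z) - u y₁) ∂μ) := by
      rw [← integral_neg, ← integral_const_mul]
      exact integral_congr_ae (.of_forall fun z => by simp only [hg]; ring)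
    have h2 : 0 ≤ -(∫ z, (u (y₁ + β z) - u y₁) ∂μ) :=
      neg_nonneg.2 (integral_nonpos fun z => sub_nonpos.2 (hy₁ _))
    have h3 : a₀ * -(∫ z, (u (y₁ + β z) - u y₁) ∂μ) ≤ 2 * C := by
      have h4 := mul_le_mul_of_nonneg_right (ha y₁) h2
      have h5 := abs_le.1 (hf y₁)
      have h6 := abs_le.1 hbd
      linarith
    rw [h1, hD]
    gcongr
    rwa [le_div_iff₀ ha₀, mul_comm]
  have hmax := mul_le_mul_of_nonneg_left (hy₁ x) hlam.le
  by_contra! hcon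
  -- On the jumps landing near `y` the integrand is at least `η / 2`, by equicontinuity.
  have hsub : {z | ∃ k, ‖β z + intVec k - (y - y₁)‖ < δ} ⊆ {z | η / 2 ≤ g z} := by
    rintro z ⟨k, hk⟩
    have h1 := hmod lam hlam u hu (y₁ + β z + intVec k) y (by
      convert hk using 2
      abel)
    rw [hu.1.add_intVec] at h1
    simp only [hg, Set.mem_ofPred_eq]
    linarith
  have hmarkov := mul_meas_ge_le_integral_of_nonneg (.of_forall hg0) hgi (η / 2)
  have hfin : μ {z | η / 2 ≤ g z} < ⊤ := hgi.measure_ge_lt_top (half_pos hη)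
  have hmreal : m ≤ μ.real {z | η / 2 ≤ g z} :=
    (ENNReal.ofReal_le_iff_le_toReal hfin.ne).1 (hmle.trans ((hmμ _).trans (measure_mono hsub)))
  rw [lt_div_iff₀ (by positivity)] at hlt
  have := mul_le_mul_of_nonneg_left hmreal (half_pos hη).le
  linarith

/-- Any two solutions with small discount factors satisfy `lam * u ≈ lam' * v`. -/
lemma IsLevyIntegrand.exists_comparison (hJ : IsLevyIntegrand β J) {a₀ C : ℝ} (ha₀ : 0 < a₀)
    (ha : ∀ y, a₀ ≤ a y) (hau : UniformContinuous a) (hfu : UniformContinuous f)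
    (hf : ∀ y, |f y| ≤ C)
    (hμ : ∀ (p : E N) (δ : ℝ), 0 < δ → 0 < μ {z | ∃ k, ‖β z + intVec k - p‖ < δ})
    {η : ℝ} (hη : 0 < η) :
    ∃ l > 0, ∀ lam lam', 0 < lam → lam < l → 0 < lam' → lam' < l → ∀ u v : E N → ℝ,
      IsPeriodicViscositySolution J μ a f lam u → IsPeriodicViscositySolution J μ a f lam' v →
      ∀ x y, lam * u x < lam' * v y + η := by
  obtain ⟨l, hl, hosc⟩ := hJ.exists_oscillation_le ha₀ ha hau hfu hf hμ
    (show 0 < η / 4 by positivity)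
  obtain ⟨ρ, hρ, hρ'⟩ := exists_le_add_of_div_le ha₀ ha hau hfu hf (show 0 < η / 4 by positivity)
  refine ⟨l, hl, fun lam lam' hlam hlt hlam' hlt' u v hu hv x y => ?_⟩
  obtain ⟨B, hB⟩ := hv.1.exists_abs_le hv.continuous
  have hB0 : 0 ≤ B := (abs_nonneg _).trans (hB 0)
  -- Here `lam` and `lam'` are fixed, so the penalization may depend on the solutions.
  set ε : ℝ := ρ ^ 2 / (2 * B + 1) with hε
  have hε0 : 0 < ε := by positivity
  obtain ⟨x₀, y₀, hmax, hd⟩ := exists_max_doubling (B := 2 * B) hu.1 hv.1 hu.continuous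
    hv.continuous hε0 fun x y => by linarith [abs_le.1 (hB x), abs_le.1 (hB y)]
  have hclose : ‖x₀ - y₀‖ < ρ := by
    refine lt_of_pow_lt_pow_left₀ 2 hρ.le (hd.trans_lt ?_)
    have h2 : (2 * B + 1) * ε = ρ ^ 2 := by rw [hε]; field_simp
    linarith
  have hpos : ∀ y, 0 < a y := fun y => ha₀.trans_le (ha y)
  have h1 := hρ' x₀ y₀ _ _ hclose (hJ.abs_mul_le hpos hf hlam' hv y₀)
    (hJ.div_le_div_of_max_doubling hpos hu.2.1 hv.2.2 hmax)
  have h2 := hosc lam hlam hlt u hu x x₀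
  have h3 := hosc lam' hlam' hlt' v hv y₀ y
  linarith

/-- The ergodic limit, for all integrands and measures whose jumps reach every open subset of the
torus with positive measure. -/
theorem IsLevyIntegrand.exists_ergodic_limit (hJ : IsLevyIntegrand β J)
    (hμ : ∀ (p : E N) (δ : ℝ), 0 < δ → 0 < μ {z | ∃ k, ‖β z + intVec k - p‖ < δ})
    (h : IsAdmissible a f) :
    ∃ d : ℝ, ∀ v : ℝ → E N → ℝ,
      (∀ lam : ℝ, 0 < lam → IsPeriodicViscositySolution J μ a f lam (v lam)) →
      TendstoUniformly (fun lam y => lam * v lam y) (fun _ => d) (𝓝[>] (0 : ℝ)) ∧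
        ∀ d' : ℝ, TendstoUniformly (fun lam y => lam * v lam y) (fun _ => d') (𝓝[>] (0 : ℝ)) →
          d' = d := by
  obtain ⟨-, hfp, ⟨a₀, ha₀, ha⟩, L, θ₁, θ₂, hL, hθ₁, hθ₂, haH, hfH⟩ := h
  have hau := haH.uniformContinuous hL hθ₁.1
  have hfu := hfH.uniformContinuous hL hθ₂.1
  obtain ⟨C, hf⟩ := hfp.exists_abs_le hfu.continuous
  by_cases hex : ∃ w : ℝ → E N → ℝ,
      ∀ lam : ℝ, 0 < lam → IsPeriodicViscositySolution J μ a f lam (w lam)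
  swap
  -- Without any family of solutions the claim is empty for every constant.
  · exact ⟨0, fun v hv => absurd ⟨v, hv⟩ hex⟩
  obtain ⟨w, hw⟩ := hex
  have hcomp : ∀ η > 0, ∀ v : ℝ → E N → ℝ,
      (∀ lam : ℝ, 0 < lam → IsPeriodicViscositySolution J μ a f lam (v lam)) →
      ∃ l > 0, ∀ lam lam', 0 < lam → lam < l → 0 < lam' → lam' < l →
        ∀ x, dist (lam * v lam x) (lam' * w lam' 0) < η := by
    intro η hη v hv
    obtain ⟨l, hl, hcmp⟩ := hJ.exists_comparison ha₀ ha hau hfu hf hμ hη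
    refine ⟨l, hl, fun lam lam' h1 h2 h3 h4 x => ?_⟩
    rw [Real.dist_eq, abs_lt]
    have e1 := hcmp lam lam' h1 h2 h3 h4 _ _ (hv lam h1) (hw lam' h3) x 0
    have e2 := hcmp lam' lam h3 h4 h1 h2 _ _ (hw lam' h3) (hv lam h1) 0 x
    constructor <;> linarith
  have hIoo : ∀ l : ℝ, 0 < l → Set.Ioo 0 l ∈ 𝓝[>] (0 : ℝ) := fun l hl =>
    Ioo_mem_nhdsGT hl
  obtain ⟨d, hd⟩ : ∃ d, Tendsto (fun lam => lam * w lam 0) (𝓝[>] (0 : ℝ)) (𝓝 d) := by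
    refine cauchy_map_iff_exists_tendsto.1 (Metric.cauchy_iff.2 ⟨inferInstance, fun η hη => ?_⟩)
    obtain ⟨l, hl, hc⟩ := hcomp η hη w hw
    refine ⟨_, image_mem_map (hIoo l hl), ?_⟩
    rintro _ ⟨s, hs, rfl⟩ _ ⟨t, ht, rfl⟩
    exact hc s t hs.1 hs.2 ht.1 ht.2 0
  refine ⟨d, fun v hv => ?_⟩
  have hlim : TendstoUniformly (fun lam y => lam * v lam y) (fun _ => d) (𝓝[>] (0 : ℝ)) := by
    rw [Metric.tendstoUniformly_iff]
    intro η hη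
    obtain ⟨l, hl, hc⟩ := hcomp (η / 2) (half_pos hη) v hv
    filter_upwards [hIoo l hl] with s hs x
    have : dist (s * v s x) d ≤ η / 2 := by
      refine le_of_tendsto (tendsto_const_nhds.dist hd) ?_
      filter_upwards [hIoo l hl] with t ht
      exact (hc s t hs.1 hs.2 ht.1 ht.2 x).le
    rw [dist_comm]
    linarith
  exact ⟨hlim, fun d' hd' => tendsto_nhds_unique (hd'.tendsto_at 0) (hlim.tendsto_at 0)⟩

end Viscosity

/-! ### The jumps of the examples reach every open subset of the torus -/

lemma stableOn_pos {M : ℕ} (hM : 1 ≤ M) {A S : Set (E M)} (hA : IsOpen A) (hS : IsOpen S)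
    (hne : (S ∩ A).Nonempty) (α : ℝ) : 0 < stableOn A α S := by
  have : Nonempty (Fin M) := ⟨⟨0, hM⟩⟩
  have hvol : 0 < volume ((S ∩ A) \ {0}) := by
    rw [measure_sdiff_null (measure_singleton _)]
    exact (hS.inter hA).measure_pos volume hne
  rw [pos_iff_ne_zero, stableOn, Ne,
    withDensity_apply_eq_zero' (by fun_prop), Measure.restrict_apply₀' hA.nullMeasurableSet]
  refine (hvol.trans_le (measure_mono ?_)).ne'
  rintro z ⟨⟨hzS, hzA⟩, hz0⟩
  refine ⟨⟨?_, hzS⟩, hzA⟩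
  have : 0 < ‖z‖ := norm_pos_iff.2 hz0
  have h := Real.rpow_pos_of_pos this (-((M : ℝ) + α))
  simpa using h

lemma stableOn_jump_pos {M N : ℕ} (hM : 1 ≤ M) {β : E M → E N} (hβ : Continuous β)
    {A : Set (E M)} (hA : IsOpen A) (α : ℝ) {p : E N} {δ : ℝ} {z : E M} (hz : z ∈ A)
    {k : Fin N → ℤ} (hk : ‖β z + intVec k - p‖ < δ) :
    0 < stableOn A α {z | ∃ k, ‖β z + intVec k - p‖ < δ} := by
  have hmem : z ∈ {z | ∃ k, ‖β z + intVec k - p‖ < δ} := ⟨k, hk⟩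
  refine stableOn_pos hM hA ?_ ⟨z, hmem, hz⟩ α
  rw [Set.ofPred_exists]
  exact isOpen_iUnion fun k => isOpen_lt (by fun_prop) continuous_const

lemma orthant_jump_pos {N : ℕ} (hN : 1 ≤ N) (α : ℝ) (p : E N) (δ : ℝ) (hδ : 0 < δ) :
    0 < stableOn (orthant N) α {z : E N | ∃ k, ‖z + intVec k - p‖ < δ} := by
  have hopen : IsOpen (orthant N) := by
    rw [orthant, Set.ofPred_forall]
    exact isOpen_iInter_of_finite fun i => isOpen_lt continuous_const (by fun_prop)
  refine stableOn_jump_pos hN continuous_id hopen α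
    (z := p + intVec fun i => 1 - ⌊p i⌋) (k := fun i => -(1 - ⌊p i⌋)) (fun i => ?_) ?_
  · have := Int.floor_le (p i)
    simp only [PiLp.add_apply, intVec_apply, Int.cast_sub, Int.cast_one]
    linarith
  · convert hδ
    rw [norm_eq_zero]
    ext i
    simp
    ring

lemma negHalfLine_jump_pos (α : ℝ) (p : E 1) (δ : ℝ) (hδ : 0 < δ) :
    0 < stableOn negHalfLine α {z : E 1 | ∃ k, ‖z + intVec k - p‖ < δ} := by
  have hopen : IsOpen negHalfLine := isOpen_lt (by fun_prop) continuous_const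
  refine stableOn_jump_pos le_rfl continuous_id hopen α
    (z := p + intVec fun i => -⌊p i⌋ - 1) (k := fun i => ⌊p i⌋ + 1) ?_ ?_
  · have := Int.lt_floor_add_one (p 0)
    simp only [negHalfLine, Set.mem_ofPred_eq, PiLp.add_apply, intVec_apply, Int.cast_sub,
      Int.cast_neg, Int.cast_one]
    linarith
  · convert hδ
    rw [norm_eq_zero]
    ext i
    simp
    ring

lemma univ_jump_pos {N : ℕ} (hN : 1 ≤ N) (α : ℝ) (p : E N) (δ : ℝ) (hδ : 0 < δ) :
    0 < stableOn Set.univ α {z : E N | ∃ k, ‖z + intVec k - p‖ < δ} := by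
  refine stableOn_jump_pos hN continuous_id isOpen_univ α (z := p) (k := 0) trivial ?_
  convert hδ
  rw [norm_eq_zero]
  ext i
  simp

/-- A line of irrational slope is dense in the two-dimensional torus. -/
lemma irrationalLine_jump_pos {γ : ℝ} (hγ : Irrational γ) (α : ℝ) (p : E 2) (δ : ℝ)
    (hδ : 0 < δ) :
    0 < stableOn Set.univ α {z : E 1 | ∃ k, ‖lineMap γ z + intVec k - p‖ < δ} := by
  have hcont : Continuous (lineMap γ) := by
    unfold lineMap
    fun_prop
  have hdense : Dense (AddSubgroup.closure {γ, (1 : ℝ)} : Set ℝ) :=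
    dense_addSubgroupClosure_pair_iff.2 (by simpa using hγ)
  obtain ⟨q, hq, hqd⟩ := hdense.exists_dist_lt (p 1 - γ * p 0) hδ
  obtain ⟨n, m, rfl⟩ := AddSubgroup.mem_closure_pair.1 hq
  -- The first coordinate matches that of `p` modulo `ℤ`, the second is approximated.
  refine stableOn_jump_pos le_rfl hcont isOpen_univ α
    (z := WithLp.toLp 2 fun _ => p 0 + n) (k := ![-n, m]) trivial ?_
  rw [EuclideanSpace.norm_eq, Fin.sum_univ_two, Real.sqrt_lt' hδ]
  rw [dist_comm, Real.dist_eq, ← sq_lt_sq₀ (abs_nonneg _) hδ.le, sq_abs] at hqd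
  simp only [lineMap, PiLp.sub_apply, PiLp.add_apply, intVec_apply, Real.norm_eq_abs, sq_abs]
  simp only [zsmul_eq_mul, mul_one] at hqd
  simp
  linarith

end LevyErgodic

theorem corollary3p3 :
    (∀ (M N : ℕ) (β : LevyErgodic.E M → LevyErgodic.E N) (μ : Measure (LevyErgodic.E M)),
      LevyErgodic.HighOrderExample M N β μ →
      ∀ a f : LevyErgodic.E N → ℝ, LevyErgodic.IsAdmissible a f →
      ∃ d : ℝ, ∀ v : ℝ → LevyErgodic.E N → ℝ,
        (∀ lam : ℝ, 0 < lam → LevyErgodic.IsPeriodicViscositySolution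
          (LevyErgodic.compensatedJump β) μ a f lam (v lam)) →
        TendstoUniformly (fun lam y => lam * v lam y) (fun _ => d) (𝓝[>] (0 : ℝ)) ∧
          ∀ d' : ℝ, TendstoUniformly (fun lam y => lam * v lam y) (fun _ => d') (𝓝[>] (0 : ℝ)) →
            d' = d) ∧
    (∀ (M N : ℕ) (β : LevyErgodic.E M → LevyErgodic.E N) (μ : Measure (LevyErgodic.E M)),
      LevyErgodic.LowOrderExample M N β μ →
      ∀ a f : LevyErgodic.E N → ℝ, LevyErgodic.IsAdmissible a f →
      ∃ d : ℝ, ∀ v : ℝ → LevyErgodic.E N → ℝ,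
        (∀ lam : ℝ, 0 < lam → LevyErgodic.IsPeriodicViscositySolution
          (LevyErgodic.plainJump β) μ a f lam (v lam)) →
        TendstoUniformly (fun lam y => lam * v lam y) (fun _ => d) (𝓝[>] (0 : ℝ)) ∧
          ∀ d' : ℝ, TendstoUniformly (fun lam y => lam * v lam y) (fun _ => d') (𝓝[>] (0 : ℝ)) →
            d' = d) := by
  refine ⟨fun M N β μ h a f haf => ?_, fun M N β μ h a f haf => ?_⟩
  · refine (LevyErgodic.isLevyIntegrand_compensatedJump β).exists_ergodic_limit ?_ haf
    cases h with
    | positiveOrthant _ hN α _ => exact LevyErgodic.orthant_jump_pos hN α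
    | negativeHalfLine α _ => exact LevyErgodic.negHalfLine_jump_pos α
    | irrationalLine γ _ hirr α _ => exact LevyErgodic.irrationalLine_jump_pos hirr α
    | wholeSpace _ hN α _ => exact LevyErgodic.univ_jump_pos hN α
  · refine (LevyErgodic.isLevyIntegrand_plainJump β).exists_ergodic_limit ?_ haf
    cases h with
    | positiveOrthant _ hN α _ => exact LevyErgodic.orthant_jump_pos hN α
    | irrationalLine γ _ hirr α _ => exact LevyErgodic.irrationalLine_jump_pos hirr α
    | wholeSpace _ hN α _ => exact LevyErgodic.univ_jump_pos hN α
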